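/- Let $\mathbb{K}$ be a field, let $G$ be a finite simple graph on the vertex set $[n]=\{1,\dots,n\}$, let $S=\mathbb{K}[x_1,\dots,x_n,y_1,\dots,y_n]$, and let $$J_G=\bigl(x_iy_j-x_jy_i \;:\; i<j,\ \{i,j\}\in E(G)\bigr)\subset S$$ be the binomial edge ideal of $G$. Assume that $G$ is closed with respect to the given labelling of its vertices, that is, the generators $x_iy_j-x_jy_i$ ($i<j$, $\{i,j\}\in E(G)$) form a (quadratic) Gröbner basis of $J_G$ with respect to the lexicographic term order on $S$ induced by $x_1>\cdots>x_n>y_1>\cdots>y_n$. Then $J_G$ is of linear type, i.e. the canonical $S$-algebra homomorphism from the symmetric algebra $\operatorname{Sym}_S(J_G)$ to the Rees algebra $\mathcal{R}(J_G)=\bigoplus_{k\ge 0}J_G^k t^k\subset S[t]$, given by $f\mapsto ft$ for $f\in J_G$, is an isomorphism, if and only if $G$ is $K_4$-free (no four vertices of $G$ are pairwise adjacent). -/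

import Mathlib

open MvPolynomial

noncomputable section

namespace BinomialEdge

/-- The index set of the variables `x_1, …, x_n, y_1, …, y_n`, listed in this order: it is the
lexicographic sum of two copies of `Fin n`, so every `x`-index precedes every `y`-index. -/
abbrev Var (n : ℕ) : Type := Fin n ⊕ₗ Fin n

/-- The polynomial ring `S = K[x_1, …, x_n, y_1, …, y_n]`. -/
abbrev PolyRing (n : ℕ) (K : Type*) [Field K] : Type _ := MvPolynomial (Var n) K

/-- The variable `x_i`. -/
def x {n : ℕ} (K : Type*) [Field K] (i : Fin n) : PolyRing n K := X (Sum.inlₗ i)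

/-- The variable `y_i`. -/
def y {n : ℕ} (K : Type*) [Field K] (i : Fin n) : PolyRing n K := X (Sum.inrₗ i)

/-- The standard generators `x_i y_j - x_j y_i`, for `i < j` and `{i, j}` an edge of `G`, of the
binomial edge ideal of `G`. -/
def generators {n : ℕ} (K : Type*) [Field K] (G : SimpleGraph (Fin n)) : Set (PolyRing n K) :=
  {f | ∃ i j : Fin n, i < j ∧ G.Adj i j ∧ f = x K i * y K j - x K j * y K i}

/-- The binomial edge ideal `J_G`. -/
def binomialEdgeIdeal {n : ℕ} (K : Type*) [Field K] (G : SimpleGraph (Fin n)) :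
    Ideal (PolyRing n K) :=
  Ideal.span (generators K G)

/-- The set `B` is a Gröbner basis of the ideal `I` of a polynomial ring over a field with respect
to the monomial order `m`: it is contained in `I`, and the leading terms of its elements generate
the initial ideal of `I`. -/
def IsGroebnerBasis {σ K : Type*} [Field K] (m : MonomialOrder σ) (B : Set (MvPolynomial σ K))
    (I : Ideal (MvPolynomial σ K)) : Prop :=
  B ⊆ (I : Set (MvPolynomial σ K)) ∧
    Ideal.span (m.leadingTerm '' B) = Ideal.span (m.leadingTerm '' (I : Set (MvPolynomial σ K)))

/-- The lexicographic monomial order with `x_1 > ⋯ > x_n > y_1 > ⋯ > y_n`.  In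
`MonomialOrder.lex` a variable with a smaller index is the larger monomial. -/
def lexOrder (n : ℕ) : MonomialOrder (Var n) := MonomialOrder.lex

/-- The graph `G` on `{1, …, n}` is closed with respect to the given labelling of its vertices
(over `K`): the standard generators of `J_G`, which are quadratic by definition, form a Gröbner
basis of `J_G` with respect to the lexicographic order with `x_1 > ⋯ > x_n > y_1 > ⋯ > y_n`. -/
def IsClosedLabelling {n : ℕ} (K : Type*) [Field K] (G : SimpleGraph (Fin n)) : Prop :=
  IsGroebnerBasis (lexOrder n) (generators K G) (binomialEdgeIdeal K G)

/-- The canonical `R`-linear map `f ↦ f t` from an ideal `I` to its Rees algebra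
`⨁ₖ I ^ k t ^ k ⊆ R[t]`. -/
def toRees {R : Type*} [CommRing R] (I : Ideal R) : I →ₗ[R] reesAlgebra I where
  toFun f := ⟨Polynomial.monomial 1 (f : R), reesAlgebra.monomial_mem.mpr (by simp)⟩
  map_add' f g := by ext1; simp
  map_smul' r f := by ext1; simp [Polynomial.smul_monomial]

/-- An ideal `I` of `R` is of linear type if the canonical `R`-algebra homomorphism from the
symmetric algebra of the `R`-module `I` to the Rees algebra of `I` is an isomorphism. -/
def IsLinearType {R : Type*} [CommRing R] (I : Ideal R) : Prop :=
  IsSymmetricAlgebra (toRees I)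

end BinomialEdge

end

/-! Suppose `G` is K4-free. The generator x_i y_j - x_j y_i with i < j is monic with leading
monomial x_i y_j, which is an edge of a bipartite graph on the variables. Closedness and K4-freeness
make this graph a forest (`IsClosedLabelling.leadingMonomialsFormForest`). The symmetric algebra is
spanned by terms x^s g^a, where g_e is the degree-one class of the generator f_e. Weigh such a term
by its degree in g, then by the leading monomial of x^s f^a. A leaf of the forest supplies exchanges
showing that two terms of equal weight agree modulo lower weight (`term_sub_mem_lowerSpan`). The
image of a term in S[t] has coefficient 1 at its own weight and 0 at higher weights, so an element
of the kernel can be pushed to ever lower weight; weights are well ordered, so it vanishes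
(`eq_zero_of_mem_lowerSpan`). Conversely, the six minors on a K4 satisfy the Plücker relation, which
holds in the Rees algebra but not in the symmetric algebra (`not_isLinearType`). -/

noncomputable section

namespace BinomialEdge

open scoped MonomialOrder

/-! ### Terms x^s g^a and their weights. -/

section Terms

variable {σ ι K B : Type*} [Field K] [CommRing B] [Algebra (MvPolynomial σ K) B]
  (m : MonomialOrder σ) (f : ι → MvPolynomial σ K) (g : ι → B)

/-- The element `x ^ s * g ^ a` of an algebra over a polynomial ring, for `τ = (s, a)`. -/
def term (τ : (σ →₀ ℕ) × (ι →₀ ℕ)) : B :=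
  algebraMap (MvPolynomial σ K) B (monomial τ.1 1) * τ.2.prod fun e k => g e ^ k

lemma term_add (τ τ' : (σ →₀ ℕ) × (ι →₀ ℕ)) :
    term (K := K) g (τ + τ') = term (K := K) g τ * term (K := K) g τ' := by
  classical
  simp only [term, Prod.fst_add, Prod.snd_add]
  rw [Finsupp.prod_add_index' (by simp) (by intros; rw [pow_add]),
    show (monomial (τ.1 + τ'.1) (1 : K)) = monomial τ.1 1 * monomial τ'.1 1 by
      simp [monomial_mul], map_mul]
  ring

/-- The exponent of the leading monomial of `x ^ s * f ^ a`. -/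
def termExponent (τ : (σ →₀ ℕ) × (ι →₀ ℕ)) : σ →₀ ℕ :=
  τ.1 + Finsupp.linearCombination ℕ (fun e => m.degree (f e)) τ.2

/-- The weight of a term `x ^ s * g ^ a`: its degree in the `g e`, and then the leading monomial of
`x ^ s * f ^ a`. -/
def termWeight (τ : (σ →₀ ℕ) × (ι →₀ ℕ)) : ℕ ×ₗ m.syn :=
  toLex (τ.2.degree, m.toSyn (termExponent m f τ))

lemma termExponent_add (τ τ' : (σ →₀ ℕ) × (ι →₀ ℕ)) :
    termExponent m f (τ + τ') = termExponent m f τ + termExponent m f τ' := by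
  simp only [termExponent, Prod.fst_add, Prod.snd_add, map_add]
  abel

lemma termWeight_add (τ τ' : (σ →₀ ℕ) × (ι →₀ ℕ)) :
    termWeight m f (τ + τ') = termWeight m f τ + termWeight m f τ' := by
  simp only [termWeight, termExponent_add, Prod.snd_add, map_add]
  rfl

lemma termWeight_congr {s s' : σ →₀ ℕ} {a a' : ι →₀ ℕ} (hd : a.degree = a'.degree)
    (he : termExponent m f (s, a) = termExponent m f (s', a')) :
    termWeight m f (s, a) = termWeight m f (s', a') := by
  simp only [termWeight, he, hd]

variable [Algebra K B]

/-- The span of the terms whose weight is smaller than `w`. -/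
def lowerSpan (w : ℕ ×ₗ m.syn) : Submodule K B :=
  Submodule.span K (term (K := K) g '' {τ | termWeight m f τ < w})

lemma term_mem_lowerSpan {τ : (σ →₀ ℕ) × (ι →₀ ℕ)} {w : ℕ ×ₗ m.syn}
    (h : termWeight m f τ < w) : term (K := K) g τ ∈ lowerSpan m f g w :=
  Submodule.subset_span ⟨τ, h, rfl⟩

lemma term_mul_mem_lowerSpan (τ : (σ →₀ ℕ) × (ι →₀ ℕ)) {w : ℕ ×ₗ m.syn} {b : B}
    (hb : b ∈ lowerSpan m f g w) :
    term (K := K) g τ * b ∈ lowerSpan m f g (termWeight m f τ + w) := by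
  induction hb using Submodule.span_induction with
  | mem b hb =>
    obtain ⟨τ', h, rfl⟩ := hb
    rw [← term_add]
    apply term_mem_lowerSpan
    rw [termWeight_add]
    exact add_lt_add_right h _
  | zero => simp
  | add b b' _ _ h h' => rw [mul_add]; exact add_mem h h'
  | smul c b _ h => rw [mul_smul_comm]; exact Submodule.smul_mem _ _ h

variable [IsScalarTower K (MvPolynomial σ K) B]

lemma smul_mem_lowerSpan {p : MvPolynomial σ K} {e : ι} {w : ℕ ×ₗ m.syn}
    (h : ∀ t ∈ p.support, termWeight m f (t, Finsupp.single e 1) < w) :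
    p • g e ∈ lowerSpan m f g w := by
  rw [← support_sum_monomial_coeff p, Finset.sum_smul]
  refine sum_mem fun t ht => ?_
  have : monomial t (coeff t p) • g e =
      coeff t p • term (K := K) g (t, Finsupp.single e 1) := by
    rw [term, Finsupp.prod_single_index (by simp), pow_one, ← Algebra.smul_def, ← smul_assoc,
      smul_monomial, smul_eq_mul, mul_one]
  rw [this]
  exact Submodule.smul_mem _ _ (term_mem_lowerSpan m f g (h t ht))

end Terms

/-! ### Exchanges between terms of equal weight. -/

section Moves

variable {σ ι K B : Type*} [Field K] [CommRing B] [Algebra (MvPolynomial σ K) B]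
  [Algebra K B] [IsScalarTower K (MvPolynomial σ K) B]
  (m : MonomialOrder σ) (f : ι → MvPolynomial σ K) (g : ι → B)

/-- Every element `p` of the ideal generated by the `f e` is a combination of the `f e` none of
whose summands has a leading monomial larger than that of `p`. -/
def HasStandardRepresentations : Prop :=
  ∀ p ∈ Ideal.span (Set.range f), ∃ c : ι →₀ MvPolynomial σ K,
    p = Finsupp.linearCombination _ f c ∧ ∀ e, m.degree (f e * c e) ≼[m] m.degree p

variable {m f g}

lemma HasStandardRepresentations.exists_degree_lt (hf : HasStandardRepresentations m f)
    (hmonic : ∀ e, m.Monic (f e)) {s s' : σ →₀ ℕ} {e e' : ι}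
    (h : s + m.degree (f e) = s' + m.degree (f e')) :
    ∃ c : ι →₀ MvPolynomial σ K,
      monomial s 1 * f e - monomial s' 1 * f e' = Finsupp.linearCombination _ f c ∧
      ∀ i, ∀ t ∈ (c i).support, t + m.degree (f i) ≺[m] s + m.degree (f e) := by
  set p := monomial s 1 * f e - monomial s' 1 * f e' with hp
  by_cases hp0 : p = 0
  · exact ⟨0, by simp [hp0], by simp⟩
  have key : ∀ (s : σ →₀ ℕ) (e : ι), m.Monic (monomial s 1 * f e) ∧
      m.degree (monomial s 1 * f e) = s + m.degree (f e) := fun s e =>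
    ⟨MonomialOrder.monic_monomial_one.mul (hmonic e), by
      classical
      rw [MonomialOrder.degree_mul (by simp) (hmonic e).ne_zero, MonomialOrder.degree_monomial]
      simp⟩
  have hpJ : p ∈ Ideal.span (Set.range f) :=
    sub_mem (Ideal.mul_mem_left _ _ (Ideal.subset_span ⟨e, rfl⟩))
      (Ideal.mul_mem_left _ _ (Ideal.subset_span ⟨e', rfl⟩))
  -- Both products are monic with the same leading monomial, so it cancels in the difference.
  have hlt : m.degree p ≺[m] s + m.degree (f e) := by
    refine lt_of_le_of_ne ?_ fun heq => ?_
    · refine MonomialOrder.degree_sub_le.trans ?_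
      rw [(key s e).2, (key s' e').2, h, max_self]
    · have h1 : coeff (m.degree p) p = 0 := by
        rw [m.toSyn.injective heq]
        rw [hp, coeff_sub, ← (key s e).2, (key s e).1.coeff_degree, (key s e).2, h, ← (key s' e').2,
          (key s' e').1.coeff_degree, sub_self]
      exact hp0 (MonomialOrder.coeff_degree_eq_zero_iff.1 h1)
  obtain ⟨c, hc, hdeg⟩ := hf p hpJ
  refine ⟨c, hc, fun i t ht => lt_of_le_of_lt ?_ (lt_of_le_of_lt (hdeg i) hlt)⟩
  have hci : c i ≠ 0 := by rintro h0; simp [h0] at ht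
  rw [MonomialOrder.degree_mul (hmonic i).ne_zero hci, map_add, map_add, add_comm]
  exact add_le_add_right (MonomialOrder.le_degree ht) _

lemma termExponent_single (s : σ →₀ ℕ) (e : ι) :
    termExponent m f (s, Finsupp.single e 1) = s + m.degree (f e) := by
  simp [termExponent]

/-- The standard representation of the S-polynomial is a syzygy of the `f e`; by `hg` the `g e`
satisfy it too, and its remaining terms have lower weight. -/
lemma term_single_sub_mem_lowerSpan (hf : HasStandardRepresentations m f)
    (hmonic : ∀ e, m.Monic (f e))
    (hg : ∀ c : ι →₀ MvPolynomial σ K, Finsupp.linearCombination _ f c = 0 →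
      Finsupp.linearCombination (MvPolynomial σ K) g c = 0)
    {s s' : σ →₀ ℕ} {e e' : ι} (h : s + m.degree (f e) = s' + m.degree (f e')) :
    term (K := K) g (s, Finsupp.single e 1) - term (K := K) g (s', Finsupp.single e' 1) ∈
      lowerSpan m f g (termWeight m f (s, Finsupp.single e 1)) := by
  obtain ⟨c, hc, hlt⟩ := hf.exists_degree_lt hmonic h
  have h1 := hg (Finsupp.single e (monomial s 1) - Finsupp.single e' (monomial s' 1) - c)
    (by simp [← hc])
  have h2 : term (K := K) g (s, Finsupp.single e 1) - term (K := K) g (s', Finsupp.single e' 1) =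
      Finsupp.linearCombination (MvPolynomial σ K) g c := by
    rw [map_sub, sub_eq_zero, map_sub] at h1
    rw [← h1]
    simp [term, Algebra.smul_def]
  rw [h2, Finsupp.linearCombination_apply]
  refine sum_mem fun i _ => smul_mem_lowerSpan m f g fun t ht => ?_
  rw [termWeight, termWeight, Prod.Lex.toLex_lt_toLex]
  right
  simp only [termExponent_single]
  exact ⟨by simp [Finsupp.degree_single], hlt i t ht⟩

/-- Every nonempty finite set of the leading monomials of the `f e`, regarded as the edges of a
graph, contains an edge with an endpoint that lies on no other edge of the set. -/
def LeadingMonomialsFormForest (m : MonomialOrder σ) (f : ι → MvPolynomial σ K) : Prop :=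
  ∀ D : Finset ι, D.Nonempty → ∃ e ∈ D, ∃ v w : σ, v ≠ w ∧
    m.degree (f e) = Finsupp.single v 1 + Finsupp.single w 1 ∧
    ∀ e' ∈ D, e' ≠ e → m.degree (f e') v = 0

lemma termExponent_apply (s : σ →₀ ℕ) (a : ι →₀ ℕ) (v : σ) :
    termExponent m f (s, a) v = s v + a.sum fun e k => k * m.degree (f e) v := by
  simp [termExponent, Finsupp.linearCombination_apply, Finsupp.sum]

/-- Finds a factor of the term `(s', b)`, linear in g, that can be traded for one containing `e`.
Since `v` divides the common exponent but no leading monomial from `b`, it divides `s'`. If `w`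
divides `s'` as well, any `e'` in `b` will do; otherwise `w` comes from some `e'` in `b`. -/
lemma exists_exchange {s s' : σ →₀ ℕ} {a b : ι →₀ ℕ} (hb : b ≠ 0)
    (hexp : termExponent m f (s, a) = termExponent m f (s', b)) {e : ι} (he : a e ≠ 0)
    {v w : σ} (hvw : v ≠ w) (hdeg : m.degree (f e) = Finsupp.single v 1 + Finsupp.single w 1)
    (hv : ∀ e' ∈ b.support, m.degree (f e') v = 0) :
    ∃ s₀ s₁ t₁ : σ →₀ ℕ, ∃ e' : ι, ∃ b' : ι →₀ ℕ, s' = s₀ + s₁ ∧ b = Finsupp.single e' 1 + b' ∧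
      s₁ + m.degree (f e') = t₁ + m.degree (f e) := by
  classical
  have hle : ∀ x, m.degree (f e) x ≤ termExponent m f (s, a) x := fun x => by
    rw [termExponent_apply]
    refine le_trans ?_ (Nat.le_add_left _ _)
    refine le_trans ?_ (Finset.single_le_sum (f := fun e => a e * m.degree (f e) x)
      (fun _ _ => Nat.zero_le _) (Finsupp.mem_support_iff.2 he))
    exact Nat.le_mul_of_pos_left _ (Nat.pos_of_ne_zero he)
  have split : ∀ e', b e' ≠ 0 → ∃ b', b = Finsupp.single e' 1 + b' := fun e' h =>
    exists_add_of_le (Finsupp.single_le_iff.2 (Nat.one_le_iff_ne_zero.2 h))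
  have hv' : 1 ≤ s' v := by
    have h1 := hle v
    rw [hexp, termExponent_apply, Finsupp.sum, Finset.sum_eq_zero fun e' h => by
      rw [hv e' h, mul_zero]] at h1
    simp [hdeg] at h1
    omega
  by_cases hw : 1 ≤ s' w
  · obtain ⟨e', he'⟩ := Finsupp.ne_iff.1 hb
    obtain ⟨b', hb'⟩ := split e' he'
    have : m.degree (f e) ≤ s' := fun x => by
      rw [hdeg, Finsupp.add_apply, Finsupp.single_apply, Finsupp.single_apply]
      by_cases h1 : v = x <;> by_cases h2 : w = x
      · exact absurd (h1.trans h2.symm) hvw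
      · subst h1; simpa [h2] using hv'
      · subst h2; simpa [h1] using hw
      · simp [h1, h2]
    obtain ⟨s₀, hs₀⟩ := exists_add_of_le this
    exact ⟨s₀, m.degree (f e), m.degree (f e'), e', b', by rw [hs₀, add_comm], hb', add_comm _ _⟩
  · obtain ⟨e', he', hw'⟩ : ∃ e' ∈ b.support, b e' * m.degree (f e') w ≠ 0 := by
      by_contra! hcon
      have h1 := hle w
      rw [hexp, termExponent_apply, Finsupp.sum, Finset.sum_eq_zero hcon] at h1
      simp [hdeg] at h1
      omega
    obtain ⟨b', hb'⟩ := split e' (Finsupp.mem_support_iff.1 he')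
    obtain ⟨s₀, hs₀⟩ := exists_add_of_le (Finsupp.single_le_iff.2 hv')
    obtain ⟨t, ht⟩ := exists_add_of_le (Finsupp.single_le_iff.2
      (Nat.one_le_iff_ne_zero.2 (right_ne_zero_of_mul hw')))
    refine ⟨s₀, Finsupp.single v 1, t, e', b', by rw [hs₀, add_comm], hb', ?_⟩
    rw [ht, hdeg]
    abel

/-- Induction on the degree in g. A common index is cancelled. If there is none, a leaf edge of the
joint support occurs on one side only, and one exchange brings it into the other side. -/
theorem term_sub_mem_lowerSpan (hf : HasStandardRepresentations m f)
    (hmonic : ∀ e, m.Monic (f e))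
    (hg : ∀ c : ι →₀ MvPolynomial σ K, Finsupp.linearCombination _ f c = 0 →
      Finsupp.linearCombination (MvPolynomial σ K) g c = 0)
    (hforest : LeadingMonomialsFormForest m f) (n : ℕ) :
    ∀ (s s' : σ →₀ ℕ) (a b : ι →₀ ℕ), a.degree = n → b.degree = n →
      termExponent m f (s, a) = termExponent m f (s', b) →
      term (K := K) g (s, a) - term (K := K) g (s', b) ∈
        lowerSpan m f g (termWeight m f (s, a)) := by
  classical
  induction n with
  | zero =>
    intro s s' a b ha hb h
    obtain rfl := (Finsupp.degree_eq_zero_iff _).1 ha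
    obtain rfl := (Finsupp.degree_eq_zero_iff _).1 hb
    obtain rfl : s = s' := by simpa [termExponent] using h
    simp
  | succ n ih =>
    have pair : ∀ (s : σ →₀ ℕ) (e : ι) (a : ι →₀ ℕ),
        (s, Finsupp.single e 1 + a) = ((0, Finsupp.single e 1) + (s, a) : (σ →₀ ℕ) × (ι →₀ ℕ)) :=
      fun s e a => by simp
    have common : ∀ (s s' : σ →₀ ℕ) (e : ι) (a b : ι →₀ ℕ),
        (Finsupp.single e 1 + a).degree = n + 1 → (Finsupp.single e 1 + b).degree = n + 1 →
        termExponent m f (s, Finsupp.single e 1 + a) =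
          termExponent m f (s', Finsupp.single e 1 + b) →
        term (K := K) g (s, Finsupp.single e 1 + a) -
          term (K := K) g (s', Finsupp.single e 1 + b) ∈
          lowerSpan m f g (termWeight m f (s, Finsupp.single e 1 + a)) := by
      intro s s' e a b ha hb h
      rw [map_add, Finsupp.degree_single] at ha hb
      rw [pair, pair s', termExponent_add, termExponent_add, add_right_inj] at h
      rw [pair, pair s', term_add, term_add, ← mul_sub, termWeight_add]
      exact term_mul_mem_lowerSpan m f g _ (ih s s' a b (by omega) (by omega) h)
    have half : ∀ (s s' : σ →₀ ℕ) (a b : ι →₀ ℕ), a.degree = n + 1 → b.degree = n + 1 →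
        termExponent m f (s, a) = termExponent m f (s', b) →
        ∀ e, a e ≠ 0 → ∀ v w : σ, v ≠ w →
        m.degree (f e) = Finsupp.single v 1 + Finsupp.single w 1 →
        (∀ e' ∈ b.support, m.degree (f e') v = 0) →
        term (K := K) g (s, a) - term (K := K) g (s', b) ∈
          lowerSpan m f g (termWeight m f (s, a)) := by
      intro s s' a b ha hb h e he v w hvw hdeg hv
      have hb0 : b ≠ 0 := by rintro rfl; simp at hb
      obtain ⟨s₀, s₁, t₁, e', b', rfl, rfl, hmove⟩ := exists_exchange hb0 h he hvw hdeg hv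
      obtain ⟨a', rfl⟩ : ∃ a', a = Finsupp.single e 1 + a' :=
        exists_add_of_le (Finsupp.single_le_iff.2 (Nat.one_le_iff_ne_zero.2 he))
      have split : ∀ (t : σ →₀ ℕ) (i : ι), (s₀ + t, Finsupp.single i 1 + b') =
          ((s₀, b') + (t, Finsupp.single i 1) : (σ →₀ ℕ) × (ι →₀ ℕ)) :=
        fun t i => by simp [add_comm]
      have h2 : termExponent m f (s₀ + s₁, Finsupp.single e' 1 + b') =
          termExponent m f (s₀ + t₁, Finsupp.single e 1 + b') := by
        rw [split, split, termExponent_add, termExponent_add, termExponent_single,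
          termExponent_single, hmove]
      have hd : (Finsupp.single e 1 + b').degree = n + 1 := by
        rw [← hb]; simp [Finsupp.degree_single]
      have h3 := common s (s₀ + t₁) e a' b' ha hd (h.trans h2)
      have h4 : term (K := K) g (s₀ + t₁, Finsupp.single e 1 + b') -
          term (K := K) g (s₀ + s₁, Finsupp.single e' 1 + b') ∈
          lowerSpan m f g (termWeight m f (s, Finsupp.single e 1 + a')) := by
        rw [termWeight_congr m f (ha.trans hd.symm) (h.trans h2), split, split, term_add,
          term_add, ← mul_sub, termWeight_add]
        exact term_mul_mem_lowerSpan m f g _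
          (term_single_sub_mem_lowerSpan hf hmonic hg hmove.symm)
      simpa using add_mem h3 h4
    intro s s' a b ha hb h
    by_cases hab : ∃ e, a e ≠ 0 ∧ b e ≠ 0
    · obtain ⟨e, hae, hbe⟩ := hab
      obtain ⟨a', rfl⟩ := exists_add_of_le
        (Finsupp.single_le_iff.2 (Nat.one_le_iff_ne_zero.2 hae))
      obtain ⟨b', rfl⟩ := exists_add_of_le
        (Finsupp.single_le_iff.2 (Nat.one_le_iff_ne_zero.2 hbe))
      exact common s s' e a' b' ha hb h
    push Not at hab
    have hne : (a.support ∪ b.support).Nonempty := by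
      obtain ⟨e, he⟩ : ∃ e, a e ≠ (0 : ι →₀ ℕ) e :=
        Finsupp.ne_iff.1 (by rintro rfl; simp at ha)
      exact ⟨e, by simpa using Or.inl he⟩
    obtain ⟨e, he, v, w, hvw, hdeg, hleaf⟩ := hforest _ hne
    by_cases hae : a e = 0
    · have hbe : b e ≠ 0 := by simpa [hae] using he
      have := half s' s b a hb ha h.symm e hbe v w hvw hdeg fun e' he' =>
        hleaf e' (Finset.mem_union_left _ he') (by rintro rfl; simp [hae] at he')
      rw [termWeight_congr m f (ha.trans hb.symm) h, ← neg_sub]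
      exact neg_mem this
    · refine half s s' a b ha hb h e hae v w hvw hdeg fun e' he' =>
        hleaf e' (Finset.mem_union_right _ he') ?_
      rintro rfl
      simp [hab _ hae] at he'

end Moves

/-! ### Descent on weights. -/

section Injectivity

variable {σ ι K B : Type*} [Field K] [CommRing B] [Algebra (MvPolynomial σ K) B]
  [Algebra K B]
  {m : MonomialOrder σ} {f : ι → MvPolynomial σ K} {g : ι → B}

/-- By `hterm`, the terms of top weight in `b` collapse to a multiple of a single term modulo lower
weight. The functional at that weight shows the multiple to be zero, so `b` lies in a smaller span.
-/
theorem eq_zero_of_mem_lowerSpan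
    (hterm : ∀ τ τ' : (σ →₀ ℕ) × (ι →₀ ℕ), termWeight m f τ = termWeight m f τ' →
      term (K := K) g τ - term (K := K) g τ' ∈ lowerSpan m f g (termWeight m f τ))
    (l : ℕ ×ₗ m.syn → B →ₗ[K] K)
    (hl : ∀ τ, l (termWeight m f τ) (term (K := K) g τ) = 1)
    (hl' : ∀ τ w, termWeight m f τ < w → l w (term (K := K) g τ) = 0)
    (w : ℕ ×ₗ m.syn) : ∀ b ∈ lowerSpan m f g w, (∀ w', l w' b = 0) → b = 0 := by
  induction w using WellFoundedLT.induction with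
  | ind w ih =>
    intro b hb hlb
    obtain ⟨F, hF, rfl⟩ := (Finsupp.mem_span_image_iff_linearCombination K).1 hb
    by_cases hne : F.support.Nonempty
    · obtain ⟨τ₀, hτ₀, hmax⟩ := F.support.exists_max_image (termWeight m f) hne
      have hlt : termWeight m f τ₀ < w := (Finsupp.mem_supported _ _).1 hF hτ₀
      set b := Finsupp.linearCombination K (term (K := K) g) F with hbdef
      have hmem : b ∈ Submodule.span K {term (K := K) g τ₀} ⊔
          lowerSpan m f g (termWeight m f τ₀) := by
        rw [hbdef, Finsupp.linearCombination_apply]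
        refine sum_mem fun τ hτ => Submodule.smul_mem _ _ ?_
        rcases (hmax τ hτ).lt_or_eq with h | h
        · exact Submodule.mem_sup_right (term_mem_lowerSpan m f g h)
        · rw [← sub_add_cancel (term (K := K) g τ) (term (K := K) g τ₀)]
          exact add_mem (Submodule.mem_sup_right (h ▸ hterm τ τ₀ h))
            (Submodule.mem_sup_left (Submodule.mem_span_singleton_self _))
      obtain ⟨b₁, hb₁, b₂, hb₂, hsum⟩ := Submodule.mem_sup.1 hmem
      obtain ⟨c, rfl⟩ := Submodule.mem_span_singleton.1 hb₁
      have hlb₂ : l (termWeight m f τ₀) b₂ = 0 := by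
        clear hsum
        induction hb₂ using Submodule.span_induction with
        | mem b hb => obtain ⟨τ, h, rfl⟩ := hb; exact hl' τ _ h
        | zero => simp
        | add b b' _ _ h h' => rw [map_add, h, h', add_zero]
        | smul c b _ h => rw [map_smul, h, smul_zero]
      have hc : c = 0 := by
        have := hlb (termWeight m f τ₀)
        rwa [← hsum, map_add, hlb₂, map_smul, hl, smul_eq_mul, mul_one, add_zero] at this
      rw [hc, zero_smul, zero_add] at hsum
      exact ih _ hlt b (hsum ▸ hb₂) hlb
    · simp [Finsupp.support_eq_empty.1 (Finset.not_nonempty_iff_eq_empty.1 hne)]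

end Injectivity

/-! ### Forests of leading monomials give linear type. -/

section LinearType

variable {σ ι K : Type*} [Field K]

lemma toRees_surjective {R : Type*} [CommRing R] (I : Ideal R) :
    Function.Surjective (SymmetricAlgebra.lift (toRees I)) := by
  have h : ((reesAlgebra I).val.comp (SymmetricAlgebra.lift (toRees I))).range =
      reesAlgebra I := by
    apply le_antisymm
    · rintro _ ⟨b, rfl⟩
      exact (SymmetricAlgebra.lift (toRees I) b).2
    · refine (adjoin_monomial_eq_reesAlgebra I).ge.trans (Algebra.adjoin_le ?_)
      rintro _ ⟨r, hr, rfl⟩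
      exact ⟨SymmetricAlgebra.ι R I ⟨r, hr⟩, by simp [toRees]⟩
  rintro ⟨p, hp⟩
  rw [← h] at hp
  obtain ⟨b, hb⟩ := hp
  exact ⟨b, Subtype.ext hb⟩

variable (m : MonomialOrder σ) (f : ι → MvPolynomial σ K)

lemma monic_term (hmonic : ∀ e, m.Monic (f e)) (τ : (σ →₀ ℕ) × (ι →₀ ℕ)) :
    m.Monic (term (K := K) f τ) ∧ m.degree (term (K := K) f τ) = termExponent m f τ := by
  classical
  obtain ⟨s, a⟩ := τ
  have h1 : m.Monic (a.prod fun e k => f e ^ k) :=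
    MonomialOrder.Monic.prod fun e _ => (hmonic e).pow
  have h2 : m.degree (a.prod fun e k => f e ^ k) =
      Finsupp.linearCombination ℕ (fun e => m.degree (f e)) a := by
    rw [Finsupp.prod, MonomialOrder.degree_prod fun e _ => pow_ne_zero _ (hmonic e).ne_zero,
      Finsupp.linearCombination_apply, Finsupp.sum]
    simp [MonomialOrder.degree_pow]
  constructor
  · exact MonomialOrder.monic_monomial_one.mul h1
  · rw [term, Algebra.algebraMap_self, RingHom.id_apply, MonomialOrder.degree_mul (by simp)
      h1.ne_zero, MonomialOrder.degree_monomial, h2]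
    simp [termExponent]

lemma span_term_eq_top (J : Ideal (MvPolynomial σ K)) (g : ι → J)
    (hg : Submodule.span (MvPolynomial σ K) (Set.range g) = ⊤) :
    Submodule.span K (Set.range (term (σ := σ) (K := K)
      fun e => SymmetricAlgebra.ι (MvPolynomial σ K) J (g e))) = ⊤ := by
  set G := fun e => SymmetricAlgebra.ι (MvPolynomial σ K) J (g e)
  set N := Submodule.span K (Set.range (term (σ := σ) (K := K) G))
  have hmul : ∀ a b, a ∈ N → b ∈ N → a * b ∈ N := by
    intro a b ha hb
    have := Submodule.mul_mem_mul ha hb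
    rw [Submodule.span_mul_span] at this
    refine Submodule.span_mono ?_ this
    rintro _ ⟨_, ⟨τ, rfl⟩, _, ⟨τ', rfl⟩, rfl⟩
    exact ⟨τ + τ', term_add _ _ _⟩
  have halg : ∀ p : MvPolynomial σ K, algebraMap _ (SymmetricAlgebra _ J) p ∈ N := by
    intro p
    rw [← support_sum_monomial_coeff p, map_sum]
    refine sum_mem fun t _ => ?_
    have : algebraMap _ (SymmetricAlgebra _ J) (monomial t (coeff t p)) =
        coeff t p • term (K := K) G (t, 0) := by
      rw [term, Finsupp.prod_zero_index, mul_one, Algebra.algebraMap_eq_smul_one,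
        Algebra.algebraMap_eq_smul_one, ← smul_assoc, smul_monomial, smul_eq_mul, mul_one]
    rw [this]
    exact Submodule.smul_mem _ _ (Submodule.subset_span ⟨_, rfl⟩)
  rw [eq_top_iff]
  rintro b -
  induction b using SymmetricAlgebra.induction with
  | algebraMap p => exact halg p
  | mul a b ha hb => exact hmul a b ha hb
  | add a b ha hb => exact add_mem ha hb
  | ι p =>
    have hp : p ∈ Submodule.span (MvPolynomial σ K) (Set.range g) := hg ▸ Submodule.mem_top
    induction hp using Submodule.span_induction with
    | mem p hp =>
      obtain ⟨e, rfl⟩ := hp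
      refine Submodule.subset_span ⟨(0, Finsupp.single e 1), ?_⟩
      simp [term, G]
    | zero => simp
    | add p q _ _ hp hq => rw [map_add]; exact add_mem hp hq
    | smul r p _ hp => rw [map_smul, Algebra.smul_def]; exact hmul _ _ (halg r) hp

variable {m f}

/-- An ideal with a monic Gröbner basis whose leading monomials are the edges of a forest is of
linear type. -/
theorem isLinearType_of_forest (hf : HasStandardRepresentations m f)
    (hmonic : ∀ e, m.Monic (f e)) (hforest : LeadingMonomialsFormForest m f) :
    IsLinearType (Ideal.span (Set.range f)) := by
  set J := Ideal.span (Set.range f) with hJ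
  refine ⟨?_, toRees_surjective J⟩
  let g : ι → J := fun e => ⟨f e, Ideal.subset_span ⟨e, rfl⟩⟩
  let G := fun e => SymmetricAlgebra.ι (MvPolynomial σ K) J (g e)
  have hspan : Submodule.span (MvPolynomial σ K) (Set.range g) = ⊤ := by
    apply Submodule.map_injective_of_injective J.subtype_injective
    rw [Submodule.map_span, Submodule.map_top, Submodule.range_subtype, ← Set.range_comp]
    rfl
  have hrel : ∀ c : ι →₀ MvPolynomial σ K, Finsupp.linearCombination _ f c = 0 →
      Finsupp.linearCombination (MvPolynomial σ K) G c = 0 := by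
    intro c hc
    have h1 : Finsupp.linearCombination (MvPolynomial σ K) g c = 0 := by
      apply J.subtype_injective
      rw [map_zero, ← hc, Finsupp.apply_linearCombination]
      rfl
    rw [← map_zero (SymmetricAlgebra.ι (MvPolynomial σ K) J), ← h1,
      Finsupp.apply_linearCombination]
    rfl
  let φ := (reesAlgebra J).val.comp (SymmetricAlgebra.lift (toRees J))
  have hφ : ∀ τ : (σ →₀ ℕ) × (ι →₀ ℕ), φ (term (K := K) G τ) =
      Polynomial.monomial τ.2.degree (term (K := K) f τ) := by
    rintro ⟨s, a⟩
    have hG : ∀ e, φ (G e) = Polynomial.monomial 1 (f e) := fun e => by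
      simp [φ, G, g, toRees]
    simp only [term, map_mul, AlgHom.commutes, Finsupp.prod, map_prod, map_pow, hG,
      Polynomial.monomial_pow, one_mul]
    have hprod : ∀ D : Finset ι, ∏ e ∈ D, Polynomial.monomial (a e) (f e ^ a e) =
        Polynomial.monomial (∑ e ∈ D, a e) (∏ e ∈ D, f e ^ a e) := by
      classical
      intro D
      induction D using Finset.induction_on with
      | empty => simp
      | insert e D he ih =>
        rw [Finset.prod_insert he, ih, Polynomial.monomial_mul_monomial, Finset.sum_insert he,
          Finset.prod_insert he]
    rw [hprod, Polynomial.algebraMap_eq, Polynomial.C_mul_monomial, Algebra.algebraMap_self,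
      RingHom.id_apply]
    rfl
  -- For `w = (k, u)`, the coefficient of x^u t^k in the image in S[t].
  let l : ℕ ×ₗ m.syn → SymmetricAlgebra (MvPolynomial σ K) J →ₗ[K] K := fun w =>
    (lcoeff K (m.toSyn.symm (ofLex w).2)) ∘ₗ
      ((Polynomial.lcoeff (MvPolynomial σ K) (ofLex w).1).restrictScalars K) ∘ₗ
      (φ.toLinearMap.restrictScalars K)
  have hlφ : ∀ w b, l w b = coeff (m.toSyn.symm (ofLex w).2) ((φ b).coeff (ofLex w).1) :=
    fun _ _ => rfl
  rw [injective_iff_map_eq_zero]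
  intro b hb
  have hbtop : b ∈ Submodule.span K (term (σ := σ) (K := K) G '' Set.univ) := by
    rw [Set.image_univ, span_term_eq_top J g hspan]; trivial
  obtain ⟨w, hw⟩ : ∃ w, b ∈ lowerSpan m f G w := by
    obtain ⟨F, -, rfl⟩ := (Finsupp.mem_span_image_iff_linearCombination K).1 hbtop
    -- The first component exceeds every degree in g that occurs, so it alone decides the
    -- lexicographic comparison.
    refine ⟨toLex (F.support.sup (fun τ => τ.2.degree) + 1, 0), ?_⟩
    rw [Finsupp.linearCombination_apply]
    refine sum_mem fun τ hτ => Submodule.smul_mem _ _ (term_mem_lowerSpan m f G ?_)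
    exact Prod.Lex.toLex_lt_toLex.2 (Or.inl (Nat.lt_succ_of_le
      (Finset.le_sup (f := fun τ : (σ →₀ ℕ) × (ι →₀ ℕ) => τ.2.degree) hτ)))
  refine eq_zero_of_mem_lowerSpan (m := m) (f := f) (g := G) ?_ l ?_ ?_ w b hw ?_
  · rintro ⟨s, a⟩ ⟨s', a'⟩ h
    have h' : (a.degree, m.toSyn (termExponent m f (s, a))) =
      (a'.degree, m.toSyn (termExponent m f (s', a'))) := toLex.injective h
    rw [Prod.mk.injEq] at h'
    exact term_sub_mem_lowerSpan hf hmonic hrel hforest _ _ _ _ _ rfl h'.1.symm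
      (m.toSyn.injective h'.2)
  · intro τ
    rw [hlφ, hφ]
    simp only [termWeight, ofLex_toLex, AddEquiv.symm_apply_apply, Polynomial.coeff_monomial_same]
    rw [← (monic_term m f hmonic τ).2]
    exact (monic_term m f hmonic τ).1.coeff_degree
  · intro τ w hτ
    rw [hlφ, hφ, Polynomial.coeff_monomial]
    split_ifs with hd
    · apply m.coeff_eq_zero_of_lt
      rw [(monic_term m f hmonic τ).2, AddEquiv.apply_symm_apply]
      rcases Prod.Lex.lt_iff.1 hτ with h | h
      · exact absurd hd h.ne
      · exact h.2
    · simp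
  · intro w
    rw [hlφ, show φ b = 0 by simp [φ, hb]]
    simp

end LinearType

/-! ### From Gröbner bases to standard representations. -/

section Groebner

variable {σ ι K : Type*} [Field K] {m : MonomialOrder σ} {f : ι → MvPolynomial σ K}
  {I : Ideal (MvPolynomial σ K)}

lemma IsGroebnerBasis.exists_degree_le (h : IsGroebnerBasis m (Set.range f) I)
    (hmonic : ∀ e, m.Monic (f e)) {p : MvPolynomial σ K} (hp : p ∈ I) (hp0 : p ≠ 0) :
    ∃ e, m.degree (f e) ≤ m.degree p := by
  classical
  have h1 : m.leadingTerm p ∈ Ideal.span (m.leadingTerm '' Set.range f) :=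
    h.2 ▸ Ideal.subset_span ⟨p, hp, rfl⟩
  have h2 : m.leadingTerm '' Set.range f =
      (fun s => monomial s 1) '' Set.range fun e => m.degree (f e) := by
    rw [← Set.range_comp, ← Set.range_comp]
    congr 1
    funext e
    simp [MonomialOrder.leadingTerm, (hmonic e).leadingCoeff_eq_one]
  rw [h2, mem_ideal_span_monomial_image] at h1
  obtain ⟨_, ⟨e, rfl⟩, he⟩ := h1 (m.degree p) (by
    rw [MonomialOrder.support_leadingTerm' hp0]; simp)
  exact ⟨e, he⟩

/-- The remainder on division by the `f e` lies in the ideal, yet no leading monomial of an `f e`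
divides any of its monomials; hence it is zero. -/
lemma IsGroebnerBasis.hasStandardRepresentations
    (h : IsGroebnerBasis m (Set.range f) (Ideal.span (Set.range f)))
    (hmonic : ∀ e, m.Monic (f e)) : HasStandardRepresentations m f := by
  intro p hp
  obtain ⟨c, r, hpr, hdeg, hr⟩ := m.div (b := f)
    (fun e => by rw [(hmonic e).leadingCoeff_eq_one]; exact isUnit_one) p
  refine ⟨c, ?_, hdeg⟩
  have hrI : r ∈ Ideal.span (Set.range f) := by
    rw [← add_sub_cancel_left (Finsupp.linearCombination _ f c) r, ← hpr]
    refine sub_mem hp ?_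
    rw [Finsupp.linearCombination_apply]
    exact sum_mem fun e _ => Ideal.mul_mem_left _ _ (Ideal.subset_span ⟨e, rfl⟩)
  by_cases hr0 : r = 0
  · rw [hpr, hr0, add_zero]
  · obtain ⟨e, he⟩ := h.exists_degree_le hmonic hrI hr0
    exact absurd he (hr _ (MonomialOrder.degree_mem_support hr0) e)

end Groebner

/-! ### Leading monomials of the minors. -/

section Minors

variable {n : ℕ} (K : Type*) [Field K]

/-- The exponent of `x_i y_j`. -/
def xyExponent (i j : Fin n) : Var n →₀ ℕ :=
  Finsupp.single (Sum.inlₗ i) 1 + Finsupp.single (Sum.inrₗ j) 1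

/-- The minor `x_i y_j - x_j y_i`. -/
def minor (i j : Fin n) : PolyRing n K := x K i * y K j - x K j * y K i

lemma x_mul_y (i j : Fin n) : x K i * y K j = monomial (xyExponent i j) 1 := by
  simp [x, y, X, xyExponent, monomial_mul]

lemma minor_eq (i j : Fin n) :
    minor K i j = monomial (xyExponent i j) 1 - monomial (xyExponent j i) 1 := by
  rw [minor, x_mul_y, x_mul_y]

lemma inl_eq_inl {i j : Fin n} : (Sum.inlₗ i : Var n) = Sum.inlₗ j ↔ i = j := by
  simp [Sum.inlₗ]

lemma inr_eq_inr {i j : Fin n} : (Sum.inrₗ i : Var n) = Sum.inrₗ j ↔ i = j := by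
  simp [Sum.inrₗ]

lemma inl_ne_inr {i j : Fin n} : (Sum.inlₗ i : Var n) ≠ Sum.inrₗ j := by
  simp [Sum.inlₗ, Sum.inrₗ]

lemma xyExponent_inl (i j k : Fin n) :
    xyExponent i j (Sum.inlₗ k) = if i = k then 1 else 0 := by
  rw [xyExponent, Finsupp.add_apply, Finsupp.single_apply, Finsupp.single_apply,
    if_neg inl_ne_inr.symm]
  simp

lemma xyExponent_inr (i j k : Fin n) :
    xyExponent i j (Sum.inrₗ k) = if j = k then 1 else 0 := by
  rw [xyExponent, Finsupp.add_apply, Finsupp.single_apply, Finsupp.single_apply,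
    if_neg inl_ne_inr]
  simp

lemma xyExponent_inj {i j k l : Fin n} : xyExponent i j = xyExponent k l ↔ i = k ∧ j = l := by
  refine ⟨fun h => ⟨?_, ?_⟩, fun h => by rw [h.1, h.2]⟩
  · by_contra hne
    have := DFunLike.congr_fun h (Sum.inlₗ i)
    simp [xyExponent_inl, Ne.symm hne] at this
  · by_contra hne
    have := DFunLike.congr_fun h (Sum.inrₗ j)
    simp [xyExponent_inr, Ne.symm hne] at this

lemma xyExponent_lt {i j : Fin n} (h : i < j) : xyExponent j i ≺[lexOrder n] xyExponent i j := by
  rw [lexOrder, MonomialOrder.lex_lt_iff, Finsupp.Lex.lt_iff]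
  refine ⟨Sum.inlₗ i, fun v hv => ?_, ?_⟩
  · rcases hk : ofLex v with k | k
    · obtain rfl : v = Sum.inlₗ k := hk
      rw [Sum.Lex.inl_lt_inl_iff] at hv
      simp [xyExponent_inl, hv.ne', (hv.trans h).ne']
    · obtain rfl : v = Sum.inrₗ k := hk
      exact absurd hv Sum.Lex.not_inr_lt_inl
  · simp [xyExponent_inl, h.ne']

lemma degree_minor {i j : Fin n} (h : i < j) :
    (lexOrder n).degree (minor K i j) = xyExponent i j := by
  classical
  rw [minor_eq, MonomialOrder.degree_sub_of_lt] <;>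
  simp [MonomialOrder.degree_monomial, xyExponent_lt h]

lemma monic_minor {i j : Fin n} (h : i < j) : (lexOrder n).Monic (minor K i j) := by
  classical
  rw [MonomialOrder.Monic, minor_eq, MonomialOrder.leadingCoeff_sub_of_lt] <;>
  simp [MonomialOrder.degree_monomial, xyExponent_lt h]

/-- The edges of `G`, written as pairs `(i, j)` with `i < j`. -/
abbrev OrderedEdge (G : SimpleGraph (Fin n)) : Type :=
  {p : Fin n × Fin n // p.1 < p.2 ∧ G.Adj p.1 p.2}

/-- The generator of the binomial edge ideal attached to an edge. -/
def edgeMinor (G : SimpleGraph (Fin n)) (e : OrderedEdge G) : PolyRing n K :=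
  minor K e.1.1 e.1.2

lemma range_edgeMinor (G : SimpleGraph (Fin n)) : Set.range (edgeMinor K G) = generators K G := by
  ext p
  constructor
  · rintro ⟨e, rfl⟩
    exact ⟨e.1.1, e.1.2, e.2.1, e.2.2, rfl⟩
  · rintro ⟨i, j, hij, hadj, rfl⟩
    exact ⟨⟨(i, j), hij, hadj⟩, rfl⟩

variable {K} {G : SimpleGraph (Fin n)}

lemma monic_edgeMinor (e : OrderedEdge G) : (lexOrder n).Monic (edgeMinor K G e) :=
  monic_minor K e.2.1

lemma degree_edgeMinor (e : OrderedEdge G) :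
    (lexOrder n).degree (edgeMinor K G e) = xyExponent e.1.1 e.1.2 :=
  degree_minor K e.2.1

lemma minor_mem {i j : Fin n} (h : i < j) (hadj : G.Adj i j) :
    minor K i j ∈ binomialEdgeIdeal K G :=
  Ideal.subset_span ⟨i, j, h, hadj, rfl⟩

lemma IsClosedLabelling.isGroebnerBasis (hG : IsClosedLabelling K G) :
    IsGroebnerBasis (lexOrder n) (Set.range (edgeMinor K G))
      (Ideal.span (Set.range (edgeMinor K G))) := by
  rw [range_edgeMinor]; exact hG

/-! ### Combinatorics of closed graphs. -/

/-- If the product of a variable and a minor lies in the ideal of a closed graph, then its leading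
monomial is divisible by that of a generator. -/
lemma IsClosedLabelling.exists_edge_le (hG : IsClosedLabelling K G) {v : Var n} {i j : Fin n}
    (hij : i < j) (h : X v * minor K i j ∈ binomialEdgeIdeal K G) :
    ∃ a b, a < b ∧ G.Adj a b ∧ xyExponent a b ≤ Finsupp.single v 1 + xyExponent i j := by
  rw [binomialEdgeIdeal, ← range_edgeMinor] at h
  have h0 := (monic_minor K hij).ne_zero
  obtain ⟨e, he⟩ := hG.isGroebnerBasis.exists_degree_le monic_edgeMinor h
    (mul_ne_zero (X_ne_zero v) h0)
  rw [MonomialOrder.degree_mul (X_ne_zero v) h0, MonomialOrder.degree_X, degree_minor K hij,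
    degree_edgeMinor] at he
  exact ⟨e.1.1, e.1.2, e.2.1, e.2.2, he⟩

/-- The S-pair of the two given generators yields y_i times the minor of `j, k`, with leading
monomial x_j y_k y_i. A generator's x_a y_b dividing it has a = j, and a < b rules out b = i. -/
lemma IsClosedLabelling.adj_of_common_left (hG : IsClosedLabelling K G) {i j k : Fin n}
    (hij : i < j) (hjk : j < k) (h₁ : G.Adj i j) (h₂ : G.Adj i k) : G.Adj j k := by
  have hmem : X (Sum.inrₗ i) * minor K j k ∈ binomialEdgeIdeal K G := by
    have : X (Sum.inrₗ i) * minor K j k = y K j * minor K i k - y K k * minor K i j := by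
      simp only [minor, x, y]; ring
    rw [this]
    exact sub_mem (Ideal.mul_mem_left _ _ (minor_mem (hij.trans hjk) h₂))
      (Ideal.mul_mem_left _ _ (minor_mem hij h₁))
  obtain ⟨a, b, hab, hadj, hle⟩ := hG.exists_edge_le hjk hmem
  have ha := hle (Sum.inlₗ a)
  have hb := hle (Sum.inrₗ b)
  simp only [Finsupp.add_apply, Finsupp.single_apply, xyExponent_inl, xyExponent_inr,
    inr_eq_inr, inl_ne_inr.symm, if_false, if_true] at ha hb
  obtain rfl : j = a := by by_contra hne; simp [hne] at ha
  by_cases hkb : k = b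
  · exact hkb ▸ hadj
  · obtain rfl : i = b := by by_contra hne; simp [hne, hkb] at hb
    exact absurd hij hab.asymm

/-- The mirror argument, with leading monomial x_k x_i y_j: now b = j, and a < b rules out a = k. -/
lemma IsClosedLabelling.adj_of_common_right (hG : IsClosedLabelling K G) {i j k : Fin n}
    (hij : i < j) (hjk : j < k) (h₁ : G.Adj i k) (h₂ : G.Adj j k) : G.Adj i j := by
  have hmem : X (Sum.inlₗ k) * minor K i j ∈ binomialEdgeIdeal K G := by
    have : X (Sum.inlₗ k) * minor K i j = x K j * minor K i k - x K i * minor K j k := by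
      simp only [minor, x, y]; ring
    rw [this]
    exact sub_mem (Ideal.mul_mem_left _ _ (minor_mem (hij.trans hjk) h₁))
      (Ideal.mul_mem_left _ _ (minor_mem hjk h₂))
  obtain ⟨a, b, hab, hadj, hle⟩ := hG.exists_edge_le hij hmem
  have ha := hle (Sum.inlₗ a)
  have hb := hle (Sum.inrₗ b)
  simp only [Finsupp.add_apply, Finsupp.single_apply, xyExponent_inl, xyExponent_inr,
    inl_eq_inl, inl_ne_inr, if_false, if_true] at ha hb
  obtain rfl : j = b := by by_contra hne; simp [hne] at hb
  by_cases hia : i = a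
  · exact hia ▸ hadj
  · obtain rfl : k = a := by by_contra hne; simp [hne, hia] at ha
    exact absurd hjk hab.asymm

lemma not_cliqueFree_four {a b c d : Fin n} (hab : G.Adj a b) (hac : G.Adj a c)
    (had : G.Adj a d) (hbc : G.Adj b c) (hbd : G.Adj b d) (hcd : G.Adj c d) :
    ¬ G.CliqueFree 4 := by
  intro h
  refine h {a, b, c, d} ⟨?_, ?_⟩
  · simp [SimpleGraph.isClique_iff, Set.pairwise_insert, hab, hac, had, hbc, hbd, hcd, hab.symm,
      hac.symm, had.symm, hbc.symm, hbd.symm, hcd.symm]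
  · simp [hab.ne, hac.ne, had.ne, hbc.ne, hbd.ne, hcd.ne]

/-- Let i be the largest first endpoint in `D`. If one edge of `D` starts there, x_i is a leaf. If
(i, j) and (i, k) both do, with j < k, then y_k is a leaf: another edge (a, k) would have a < i, and
closedness would make a, i, j, k a clique. -/
lemma IsClosedLabelling.leadingMonomialsFormForest (hG : IsClosedLabelling K G)
    (h4 : G.CliqueFree 4) : LeadingMonomialsFormForest (lexOrder n) (edgeMinor K G) := by
  intro D hD
  simp only [degree_edgeMinor]
  obtain ⟨e₀, he₀, hmax⟩ := D.exists_max_image (fun e => e.1.1) hD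
  have hkey : ∀ e ∈ D, ∀ e₁ : OrderedEdge G, e.1.1 = e₀.1.1 → e₁.1.1 = e₀.1.1 →
      e₁.1.2 < e.1.2 → ∃ e ∈ D, ∃ v w : Var n, v ≠ w ∧
        xyExponent e.1.1 e.1.2 = Finsupp.single v 1 + Finsupp.single w 1 ∧
        ∀ e' ∈ D, e' ≠ e → xyExponent e'.1.1 e'.1.2 v = 0 := by
    rintro ⟨⟨i, k⟩, hik, hadjik⟩ he ⟨⟨i₁, j⟩, hij, hadjij⟩ hi hi₁ hjk
    dsimp only at hi hi₁ hik hij hadjik hadjij hjk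
    obtain rfl : i₁ = i := hi₁.trans hi.symm
    refine ⟨_, he, Sum.inrₗ k, Sum.inlₗ i₁, inl_ne_inr.symm, add_comm _ _, ?_⟩
    rintro ⟨⟨a, b⟩, hab, hadjab⟩ he' hne
    rw [xyExponent_inr, if_neg]
    rintro rfl
    dsimp only at hab hadjab hjk
    have hai : a < i₁ := by
      refine lt_of_le_of_ne (hi ▸ hmax _ he') ?_
      rintro rfl
      exact hne rfl
    have hjk' := hG.adj_of_common_left hij hjk hadjij hadjik
    exact not_cliqueFree_four (hG.adj_of_common_right hai hik hadjab hadjik)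
      (hG.adj_of_common_right (hai.trans hij) hjk hadjab hjk') hadjab hadjij hadjik hjk' h4
  by_cases hex : ∃ e ∈ D, e ≠ e₀ ∧ e.1.1 = e₀.1.1
  · obtain ⟨e, he, hne, hi⟩ := hex
    rcases lt_trichotomy e.1.2 e₀.1.2 with h | h | h
    · exact hkey e₀ he₀ e rfl hi h
    · exact absurd (Subtype.ext (Prod.ext hi h)) hne
    · exact hkey e he e₀ hi rfl h
  · push Not at hex
    refine ⟨e₀, he₀, Sum.inlₗ e₀.1.1, Sum.inrₗ e₀.1.2, inl_ne_inr, rfl, fun e' he' hne => ?_⟩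
    rw [xyExponent_inl, if_neg (hex e' he' hne)]

/-! ### A K4 obstructs linear type. -/

lemma coeff_eq_zero_of_mem {p : PolyRing n K} (hp : p ∈ binomialEdgeIdeal K G)
    {t : Var n →₀ ℕ} (ht : t.degree < 2) : coeff t p = 0 := by
  classical
  induction hp using Submodule.span_induction generalizing t with
  | mem p hp =>
    obtain ⟨i, j, -, -, rfl⟩ := hp
    have hne : ∀ i j : Fin n, xyExponent i j ≠ t := by
      rintro i j rfl
      simp [xyExponent, Finsupp.degree_single] at ht
    rw [x_mul_y, x_mul_y, coeff_sub, coeff_monomial, coeff_monomial, if_neg (hne _ _),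
      if_neg (hne _ _), sub_zero]
  | zero => simp
  | add p q _ _ hp hq => rw [coeff_add, hp ht, hq ht, add_zero]
  | smul r p _ hp =>
    rw [smul_eq_mul, coeff_mul]
    refine Finset.sum_eq_zero fun u hu => ?_
    rw [Finset.HasAntidiagonal.mem_antidiagonal] at hu
    rw [hp, mul_zero]
    rw [← hu, map_add] at ht
    omega

/-- The ideal starts in degree 2, so only the constant term of `r` contributes. This makes quadratic
coefficients S-linear maps to the residue field at the origin. -/
lemma coeff_mul_of_mem {p : PolyRing n K} (hp : p ∈ binomialEdgeIdeal K G) (r : PolyRing n K)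
    {t : Var n →₀ ℕ} (ht : t.degree = 2) : coeff t (r * p) = constantCoeff r * coeff t p := by
  classical
  rw [coeff_mul, Finset.sum_eq_single (0, t)]
  · rfl
  · rintro ⟨u, v⟩ hu hne
    rw [Finset.HasAntidiagonal.mem_antidiagonal] at hu
    dsimp only at hu ⊢
    rw [coeff_eq_zero_of_mem hp, mul_zero]
    have hu0 : u ≠ 0 := by
      rintro rfl
      exact hne (by rw [← hu, zero_add])
    rw [← hu, map_add] at ht
    have := mt (Finsupp.degree_eq_zero_iff u).1 hu0
    omega
  · simp

lemma not_isLinearType {a b c d : Fin n} (hab : a < b) (hbc : b < c) (hcd : c < d)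
    (h₁₂ : G.Adj a b) (h₁₃ : G.Adj a c) (h₁₄ : G.Adj a d) (h₂₃ : G.Adj b c) (h₂₄ : G.Adj b d)
    (h₃₄ : G.Adj c d) : ¬ IsLinearType (binomialEdgeIdeal K G) := by
  classical
  intro h
  set J := binomialEdgeIdeal K G
  let _ : Algebra (PolyRing n K) K := (constantCoeff (σ := Var n) (R := K)).toAlgebra
  have hdeg : ∀ i j : Fin n, (xyExponent i j).degree = 2 := fun i j => by
    simp [xyExponent, Finsupp.degree_single]
  -- Of the six minors on `a, b, c, d`, this is 1 on those of `a, b` and `c, d`, and 0 on the other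
  -- four.
  let φ : J →ₗ[PolyRing n K] K :=
    { toFun := fun p => coeff (xyExponent a b) (p : PolyRing n K) +
        coeff (xyExponent c d) (p : PolyRing n K)
      map_add' := fun p q => by simp only [Submodule.coe_add, coeff_add]; ring
      map_smul' := fun r p => by
        change coeff _ (r * (p : PolyRing n K)) + coeff _ (r * (p : PolyRing n K)) =
          constantCoeff r * _
        rw [coeff_mul_of_mem p.2 r (hdeg _ _), coeff_mul_of_mem p.2 r (hdeg _ _), mul_add] }
  let F : ∀ i j : Fin n, i < j → G.Adj i j → J := fun i j hij hadj =>
    ⟨minor K i j, minor_mem hij hadj⟩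
  have hac := hab.trans hbc
  have hbd := hbc.trans hcd
  have had := hac.trans hcd
  -- The Plücker relation of a 2 × 4 matrix.
  have hpl : toRees J (F a b hab h₁₂) * toRees J (F c d hcd h₃₄) -
      toRees J (F a c hac h₁₃) * toRees J (F b d hbd h₂₄) +
      toRees J (F a d had h₁₄) * toRees J (F b c hbc h₂₃) = 0 := by
    apply Subtype.ext
    simp only [toRees, F, LinearMap.coe_mk, AddHom.coe_mk, Subalgebra.coe_add, Subalgebra.coe_sub,
      Subalgebra.coe_mul, Subalgebra.coe_zero, Polynomial.monomial_mul_monomial]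
    rw [← map_sub, ← map_add, minor, minor, minor, minor, minor, minor]
    have hzero : ∀ p : PolyRing n K, p = 0 →
        Polynomial.monomial (1 + 1) p = (0 : Polynomial (PolyRing n K)) :=
      fun p hp => by rw [hp, map_zero]
    exact hzero _ (by ring)
  -- Linear type would extend `φ` to an algebra map on the Rees algebra, which sends the relation to
  -- 1 = 0.
  have hval := congrArg (h.lift φ) hpl
  simp only [map_add, map_sub, map_mul, h.lift_eq, map_zero] at hval
  simp only [φ, F, LinearMap.coe_mk, AddHom.coe_mk, minor_eq, coeff_sub, coeff_monomial,
    xyExponent_inj] at hval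
  simp [hab.ne, hab.ne', hac.ne, hac.ne', had.ne, had.ne', hbc.ne, hbc.ne', hbd.ne, hbd.ne',
    hcd.ne, hcd.ne'] at hval

end Minors

end BinomialEdge
end

theorem corollary3p6 {K : Type*} [Field K] {n : ℕ} (G : SimpleGraph (Fin n))
    (hG : BinomialEdge.IsClosedLabelling K G) :
    BinomialEdge.IsLinearType (BinomialEdge.binomialEdgeIdeal K G) ↔ G.CliqueFree 4 := by
  constructor
  · intro h s hs
    -- Lists the clique increasingly, since the minors are indexed by ordered pairs.
    let o := s.orderEmbOfFin hs.card_eq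
    have hadj : ∀ i j : Fin 4, i ≠ j → G.Adj (o i) (o j) := fun i j hij =>
      hs.isClique (s.orderEmbOfFin_mem hs.card_eq i) (s.orderEmbOfFin_mem hs.card_eq j)
        (o.injective.ne hij)
    exact BinomialEdge.not_isLinearType (a := o 0) (b := o 1) (c := o 2) (d := o 3)
      (o.strictMono (by decide)) (o.strictMono (by decide)) (o.strictMono (by decide))
      (hadj _ _ (by decide)) (hadj _ _ (by decide)) (hadj _ _ (by decide))
      (hadj _ _ (by decide)) (hadj _ _ (by decide)) (hadj _ _ (by decide)) h
  · intro h4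
    have := BinomialEdge.isLinearType_of_forest
      (hG.isGroebnerBasis.hasStandardRepresentations BinomialEdge.monic_edgeMinor)
      BinomialEdge.monic_edgeMinor (hG.leadingMonomialsFormForest h4)
    rwa [BinomialEdge.range_edgeMinor] at this
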